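/- **Corollary 3.11.** Let $I$ be a finite non-empty set and let $A=(a_{ij})_{i,j\in I}$ be an E-generalized Cartan matrix: a real matrix with $a_{ii}=2$, with $a_{ij}\le 0$ for $i\ne j$, with $a_{ij}\neq 0\Rightarrow a_{ji}\ne 0$, and such that for $i\neq j$ either $a_{ij}a_{ji}\ge 4$ or $a_{ij}a_{ji}=4\cos^2(\pi/k_{ij})$ for an integer $k_{ij}\ge 2$. Put $m_{ij}=\infty$ in the first case and $m_{ij}=k_{ij}$ in the second. Let $W$ be the Coxeter group with generators $s_i$ $(i\in I)$ and relations $s_i^2=\varepsilon$ and $(s_is_j)^{m_{ij}}=\varepsilon$ for $i\ne j$ with $m_{ij}<\infty$. Let $V$ be the real vector space with basis $(\alpha_i)_{i\in I}$, let $B$ be the bilinear form on $V$ with $B(\alpha_i,\alpha_j)=\tfrac12 a_{ij}$, and let $W$ act linearly on $V$ by $s_i.v=v-2B(\alpha_i,v)\alpha_i$. Let $\Phi=\Phi_A=\{w.\alpha_i : w\in W,\ i\in I\}$, let $\Phi^+=\Phi_A^+$ be the set of elements of $\Phi$ whose coordinates in the basis $(\alpha_i)$ are all nonnegative, and for $\alpha\in\Phi$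 let $\mathfrak S_A(\alpha)=\{K\alpha : K\in\mathbb R\}\cap\Phi^+$. Let $\Phi_{\mathrm{std}}^+$ be the set $\Phi^+$ obtained when $A$ is replaced by the symmetric matrix with diagonal entries $2$ and off-diagonal entries $-2\cos(\pi/m_{ij})$ ($-2$ if $m_{ij}=\infty$), which has the same Coxeter group $W$ (the standard geometric representation). Call distinct $i,j$ odd neighbours if $m_{ij}$ is finite and odd. The ON-connected components of $A$ are the submatrices $A'=(a_{ij})_{i,j\in J}$, where $J$ runs over the connected components of the graph on $I$ whose edges are the pairs of odd neighbours (with $\Gamma'$ the corresponding subgraph of the graph $\Gamma$ attached to $A$). Suppose $W$ is finite. Then $\Phi^+$ and $\Phi^+_{\mathrm{std}}$ are finite; for every ON-connected component $(\Gamma',A')$ with index set $J$ the set $\mathfrak S_{A'}(\alpha_x)$ (formed in the root system of $A'$) is finite for each $x\in J$, and its cardinality $f_{\Gamma',A'}:=|\mathfrak S_{A'}(\alpha_x)|$ does not depend on the choice of $x\in J$; and $$f_1\,|\Phi_{\mathrm{std}}^+|\ \le\ |\Phi^+|\ \le\ f_2\,|\Phi_{\mathrm{std}}^+|,$$ where $f_1$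 and $f_2$ are the minimum and the maximum of $f_{\Gamma',A'}$ over all ON-connected components $(\Gamma',A')$ of $A$. -/

import Mathlib

/-- An E-generalized Cartan matrix with index set `I`: real entries, `2` on the diagonal, nonpositive
off the diagonal, `a i j ≠ 0` implies `a j i ≠ 0`, and every product `a i j * a j i` of transpose
entries off the diagonal is either `≥ 4` or equal to `4 cos² (π / k)` for an integer `k ≥ 2`. -/
structure EGCM (I : Type*) where
  a : I → I → ℝ
  diag : ∀ i, a i i = 2
  nonpos : ∀ i j, i ≠ j → a i j ≤ 0
  ne_zero_symm : ∀ i j, a i j ≠ 0 → a j i ≠ 0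
  prod_spec : ∀ i j, i ≠ j → 4 ≤ a i j * a j i ∨
    ∃ k : ℕ, 2 ≤ k ∧ a i j * a j i = 4 * Real.cos (Real.pi / k) ^ 2

namespace EGCM

open Classical in
/-- The integer `k ≥ 2` with `x = 4 cos² (π / k)` if there is one (it is then unique), and `0`,
which encodes `∞` as in Mathlib's Coxeter matrices, otherwise. -/
noncomputable def orderOfProd (x : ℝ) : ℕ :=
  if h : ∃ k : ℕ, 2 ≤ k ∧ x = 4 * Real.cos (Real.pi / k) ^ 2 then h.choose else 0

theorem orderOfProd_spec {x : ℝ} (h : orderOfProd x ≠ 0) :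
    2 ≤ orderOfProd x ∧ x = 4 * Real.cos (Real.pi / orderOfProd x) ^ 2 := by
  unfold orderOfProd at h ⊢
  split_ifs at h ⊢ with h'
  · exact h'.choose_spec
  · exact absurd rfl h

theorem cos_pi_div_injective {k l : ℕ} (hk : 2 ≤ k) (hl : 2 ≤ l)
    (h : 4 * Real.cos (Real.pi / k) ^ 2 = 4 * Real.cos (Real.pi / l) ^ 2) : k = l := by
  have hpi := Real.pi_pos
  have key : ∀ n : ℕ, 2 ≤ n → 0 ≤ Real.pi / n ∧ Real.pi / n ≤ Real.pi / 2 := fun n hn => by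
    have hn' : (2 : ℝ) ≤ n := by exact_mod_cast hn
    exact ⟨by positivity, by gcongr⟩
  obtain ⟨hk0, hk1⟩ := key k hk
  obtain ⟨hl0, hl1⟩ := key l hl
  have hck := Real.cos_nonneg_of_neg_pi_div_two_le_of_le (by linarith) hk1
  have hcl := Real.cos_nonneg_of_neg_pi_div_two_le_of_le (by linarith) hl1
  have hc : Real.cos (Real.pi / k) = Real.cos (Real.pi / l) := by
    have h' : Real.cos (Real.pi / k) ^ 2 = Real.cos (Real.pi / l) ^ 2 := by linarith
    exact (sq_eq_sq₀ hck hcl).1 h'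
  have ha := Real.injOn_cos ⟨hk0, by linarith⟩ ⟨hl0, by linarith⟩ hc
  have hk' : (0 : ℝ) < k := by exact_mod_cast (by omega : 0 < k)
  have hl' : (0 : ℝ) < l := by exact_mod_cast (by omega : 0 < l)
  rw [div_eq_div_iff hk'.ne' hl'.ne'] at ha
  have := mul_left_cancel₀ hpi.ne' ha
  exact_mod_cast this.symm

theorem orderOfProd_cos {k : ℕ} (hk : 2 ≤ k) :
    orderOfProd (4 * Real.cos (Real.pi / k) ^ 2) = k := by
  have h : ∃ l : ℕ, 2 ≤ l ∧ 4 * Real.cos (Real.pi / k) ^ 2 = 4 * Real.cos (Real.pi / l) ^ 2 :=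
    ⟨k, hk, rfl⟩
  unfold orderOfProd
  rw [dif_pos h]
  exact (cos_pi_div_injective hk h.choose_spec.1 h.choose_spec.2).symm

theorem orderOfProd_of_le {x : ℝ} (hx : 4 ≤ x) : orderOfProd x = 0 := by
  by_contra h
  obtain ⟨h2, he⟩ := orderOfProd_spec h
  have hk : (2 : ℝ) ≤ orderOfProd x := by exact_mod_cast h2
  have hpi := Real.pi_pos
  have h4 : 0 < Real.pi / orderOfProd x := by positivity
  have h5 : Real.pi / orderOfProd x < Real.pi := div_lt_self hpi (by linarith)
  have := Real.sin_pos_of_pos_of_lt_pi h4 h5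
  have := Real.sin_sq_add_cos_sq (Real.pi / orderOfProd x)
  nlinarith

variable {I : Type*} (A : EGCM I)

open Classical in
/-- The Coxeter matrix `m i j` of `A` (with `0` for `∞`). -/
noncomputable def coxeterMatrix : CoxeterMatrix I where
  M := fun i j => if i = j then 1 else orderOfProd (A.a i j * A.a j i)
  isSymm := by
    refine Matrix.IsSymm.ext fun i j => ?_
    simp only [mul_comm (A.a j i), eq_comm (a := j)]
  diagonal := fun i => by simp
  off_diagonal := fun i j hij => by
    rw [if_neg hij]
    intro h
    have := (orderOfProd_spec (x := A.a i j * A.a j i) (by omega)).1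
    omega

theorem coxeterMatrix_of_ne {i j : I} (h : i ≠ j) :
    A.coxeterMatrix i j = orderOfProd (A.a i j * A.a j i) := if_neg h

/-- The Coxeter group `W(Γ, A)`, presented by the generators `s i` and the Coxeter relations. -/
abbrev W : Type _ := A.coxeterMatrix.Group

/-- The possibly asymmetric bilinear form on the space `V = I →₀ ℝ` with basis
`α i = Finsupp.single i 1`, given by `B (α i) (α j) = a i j / 2`. -/
noncomputable def B : (I →₀ ℝ) →ₗ[ℝ] (I →₀ ℝ) →ₗ[ℝ] ℝ :=
  Finsupp.linearCombination ℝ fun i => Finsupp.linearCombination ℝ fun j => A.a i j / 2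

theorem two_B_single (i j : I) :
    ((2 : ℝ) • A.B (Finsupp.single i 1)) (Finsupp.single j 1) = A.a i j := by
  simp [B]
  ring

theorem two_B_self (i : I) : ((2 : ℝ) • A.B (Finsupp.single i 1)) (Finsupp.single i 1) = 2 := by
  rw [two_B_single, A.diag]

/-- The operator `S i : v ↦ v - 2 B (α i) v • α i`. -/
noncomputable def S (i : I) : (I →₀ ℝ) ≃ₗ[ℝ] (I →₀ ℝ) := Module.reflection (A.two_B_self i)

theorem S_apply (i : I) (v : I →₀ ℝ) :
    A.S i v = v - (2 * A.B (Finsupp.single i 1) v) • Finsupp.single i 1 := by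
  simp [S, Module.reflection_apply]

/-- The operators `S i` satisfy the Coxeter relations. -/
theorem S_isLiftable : A.coxeterMatrix.IsLiftable A.S := by
  intro i j
  by_cases hij : i = j
  · subst hij
    rw [CoxeterMatrix.diagonal, pow_one]
    exact LinearEquiv.ext fun v => Module.involutive_reflection (A.two_B_self i) v
  have hm : A.coxeterMatrix i j = orderOfProd (A.a i j * A.a j i) :=
    A.coxeterMatrix_of_ne hij
  by_cases h0 : A.coxeterMatrix i j = 0
  · rw [h0, pow_zero]
  rw [hm] at h0
  obtain ⟨h2, he⟩ := orderOfProd_spec h0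
  rw [← hm] at h2 he
  generalize A.coxeterMatrix i j = m at h2 he
  refine LinearEquiv.ext fun v => ?_
  unfold S
  rw [Module.reflection_mul_reflection_pow_apply (A.two_B_self i) (A.two_B_self j) m v]
  rw [A.two_B_single i j, A.two_B_single j i]
  by_cases hm2 : m = 2
  · subst hm2
    have h00 : A.a i j * A.a j i = 0 := by simpa using he
    have h1 : A.a i j = 0 := by
      by_contra hne
      exact (mul_ne_zero hne (A.ne_zero_symm i j hne)) h00
    have h3 : A.a j i = 0 := by
      by_contra hne
      exact (mul_ne_zero (A.ne_zero_symm j i hne) hne) h00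
    rw [h1, h3]
    simp
    module
  have hmR : (3 : ℝ) ≤ m := by exact_mod_cast (by omega : 3 ≤ m)
  have hpi := Real.pi_pos
  set θ : ℝ := 2 * (Real.pi / m) with hθ
  have ht : A.a i j * A.a j i - 2 = 2 * Real.cos θ := by
    rw [he, hθ, Real.cos_two_mul]
    ring
  have hθpos : 0 < θ := by positivity
  have hθlt : θ < Real.pi := by
    rw [hθ, ← mul_div_assoc, div_lt_iff₀ (by linarith)]
    nlinarith
  have hsin : Real.sin θ ≠ 0 := (Real.sin_pos_of_pos_of_lt_pi hθpos hθlt).ne'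
  have hmθ : (m : ℝ) * θ = 2 * Real.pi := by
    rw [hθ]
    field_simp
  rw [ht]
  have hS : ∀ n : ℤ, (Polynomial.Chebyshev.S ℝ n).eval (2 * Real.cos θ) * Real.sin θ =
      Real.sin ((n + 1) * θ) := fun n => Polynomial.Chebyshev.S_two_mul_real_cos θ n
  rcases Nat.even_or_odd' m with ⟨k, hk | hk⟩
  · have e1 : ((m : ℤ) - 2) / 2 = k - 1 := by omega
    have e2 : ((m : ℤ) - 1) / 2 = k - 1 := by omega
    have hz : (Polynomial.Chebyshev.S ℝ (k - 1)).eval (2 * Real.cos θ) = 0 := by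
      have h := hS (k - 1)
      have hkθ : (((k : ℤ) - 1 : ℤ) + 1 : ℝ) * θ = Real.pi := by
        rw [hk] at hmθ
        push_cast at hmθ ⊢
        linarith
      rw [hkθ, Real.sin_pi] at h
      exact (mul_eq_zero.1 h).resolve_right hsin
    rw [e1, e2, hz]
    simp
  · have e1 : ((m : ℤ) - 2) / 2 = k - 1 := by omega
    have e2 : ((m : ℤ) - 1) / 2 = k := by omega
    have e3 : ((m : ℤ) - 3) / 2 = k - 1 := by omega
    have e4 : (m : ℤ) / 2 = k := by omega
    have hz : (Polynomial.Chebyshev.S ℝ k).eval (2 * Real.cos θ) +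
        (Polynomial.Chebyshev.S ℝ (k - 1)).eval (2 * Real.cos θ) = 0 := by
      have h1 := hS k
      have h3 := hS (k - 1)
      have hkθ : (((k : ℤ) : ℝ) + 1) * θ = 2 * Real.pi - (((k : ℤ) - 1 : ℤ) + 1 : ℝ) * θ := by
        rw [hk] at hmθ
        push_cast at hmθ ⊢
        linarith
      rw [hkθ, Real.sin_two_pi_sub, ← h3] at h1
      have : ((Polynomial.Chebyshev.S ℝ k).eval (2 * Real.cos θ) +
        (Polynomial.Chebyshev.S ℝ (k - 1)).eval (2 * Real.cos θ)) * Real.sin θ = 0 := by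
        linarith
      exact (mul_eq_zero.1 this).resolve_right hsin
    rw [e1, e2, e3, e4, hz]
    simp

/-- The geometric representation `σ : W → GL(V)`, the homomorphism with `σ (s i) = S i`. -/
noncomputable def σ : A.W →* ((I →₀ ℝ) ≃ₗ[ℝ] (I →₀ ℝ)) :=
  A.coxeterMatrix.toCoxeterSystem.lift ⟨A.S, A.S_isLiftable⟩

theorem σ_simple (i : I) : A.σ (A.coxeterMatrix.simple i) = A.S i :=
  A.coxeterMatrix.toCoxeterSystem.lift_apply_simple A.S_isLiftable i

/-- The root system `Φ = {w.α i}`. -/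
def roots : Set (I →₀ ℝ) := {v | ∃ (w : A.W) (i : I), v = A.σ w (Finsupp.single i 1)}

/-- The set `Φ⁺` of roots all of whose coordinates are nonnegative. -/
def posRoots : Set (I →₀ ℝ) := {v | v ∈ A.roots ∧ ∀ i, 0 ≤ v i}

/-- `𝔖(v)`: the positive roots that are real multiples of `v`. -/
def posMultiples (v : I →₀ ℝ) : Set (I →₀ ℝ) := {u | u ∈ A.posRoots ∧ ∃ K : ℝ, u = K • v}

/-- The graph of odd neighbours: distinct `i`, `j` are joined iff `m i j` is (finite and) odd. -/
def onGraph : SimpleGraph I where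
  Adj i j := i ≠ j ∧ Odd (A.coxeterMatrix i j)
  symm := ⟨fun i j h => ⟨h.1.symm, A.coxeterMatrix.symmetric i j ▸ h.2⟩⟩
  loopless := ⟨fun _ h => h.1 rfl⟩

/-- The E-generalized Cartan submatrix with index set `J ⊆ I`. -/
def restrict (J : Set I) : EGCM J where
  a i j := A.a i j
  diag i := A.diag i
  nonpos i j h := A.nonpos i j fun e => h (Subtype.ext e)
  ne_zero_symm i j h := A.ne_zero_symm i j h
  prod_spec i j h := A.prod_spec i j fun e => h (Subtype.ext e)

/-- The ON-connected component `(Γ', A')` of `(Γ, A)` belonging to a connected component of the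
graph of odd neighbours, as an E-generalized Cartan matrix in its own right. -/
abbrev component (C : A.onGraph.ConnectedComponent) : EGCM C.supp := A.restrict C.supp

/-- For ON-connected `(Γ, A)`, the number `f_{Γ, A} = |𝔖(α x)|` for any node `x`. -/
noncomputable def f [Nonempty I] : ℕ :=
  (A.posMultiples (Finsupp.single (Classical.arbitrary I) 1)).ncard

/-- The number `f_{Γ', A'}` of an ON-connected component `(Γ', A')`, computed in the root system
of `(Γ', A')`. -/
noncomputable def fComponent (C : A.onGraph.ConnectedComponent) : ℕ :=
  haveI : Nonempty C.supp := C.nonempty_supp.to_subtype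
  (A.component C).f

/-- The matrix of the standard geometric representation of `W(Γ, A)`: the symmetric matrix with
entries `-2 cos (π / m i j)`, which is `2` for `i = j`, and `-2` for `m i j = ∞` (encoded as `0`). -/
noncomputable def std : EGCM I where
  a i j := if A.coxeterMatrix i j = 0 then -2 else -2 * Real.cos (Real.pi / A.coxeterMatrix i j)
  diag i := by simp
  nonpos i j hij := by
    split_ifs with h
    · norm_num
    · have h1 := A.coxeterMatrix.off_diagonal i j hij
      have h2 : (2 : ℝ) ≤ A.coxeterMatrix i j := by
        exact_mod_cast (by omega : 2 ≤ A.coxeterMatrix i j)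
      have h3 : Real.pi / A.coxeterMatrix i j ≤ Real.pi / 2 := by
        have := Real.pi_pos
        gcongr
      have h4 : 0 ≤ Real.pi / A.coxeterMatrix i j := by
        have := Real.pi_pos
        positivity
      have := Real.cos_nonneg_of_neg_pi_div_two_le_of_le (by linarith [Real.pi_pos]) h3
      linarith
  ne_zero_symm i j h := by rwa [A.coxeterMatrix.symmetric j i]
  prod_spec i j hij := by
    rw [A.coxeterMatrix.symmetric j i]
    split_ifs with h
    · left; norm_num
    · right
      have h1 := A.coxeterMatrix.off_diagonal i j hij
      exact ⟨A.coxeterMatrix i j, by omega, by ring⟩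

/-- The matrix `A.std` has the same Coxeter group as `A`. -/
theorem std_coxeterMatrix : A.std.coxeterMatrix = A.coxeterMatrix := by
  ext i j
  by_cases hij : i = j
  · subst hij
    rw [CoxeterMatrix.diagonal, CoxeterMatrix.diagonal]
  · rw [A.std.coxeterMatrix_of_ne hij]
    have h1 := A.coxeterMatrix.off_diagonal i j hij
    by_cases h : A.coxeterMatrix i j = 0
    · rw [h]
      refine orderOfProd_of_le ?_
      simp only [std, A.coxeterMatrix.symmetric j i, h, if_true]
      norm_num
    · have he : A.std.a i j * A.std.a j i =
          4 * Real.cos (Real.pi / A.coxeterMatrix i j) ^ 2 := by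
        simp only [std, A.coxeterMatrix.symmetric j i, h, if_false]
        ring
      rw [he]
      exact orderOfProd_cos (by omega)

end EGCM

/-! Positive roots are counted by fibering them over the reflections of `W`: a root `w.α i` goes to
`w s_i w⁻¹`. Every bound comes from the sizes of the fibers. The sign lemma `σ_α_nonneg` says that
`w.α i` has nonnegative coordinates unless `i` is a right descent of `w`. It rests on the rank two
formula `σ_alternatingWord_α`, whose coefficients are Chebyshev values, and it makes the
representation faithful. If `W` is finite, two roots have the same reflection exactly when they are
proportional (`reflectionOf_eq_iff`). So each fiber is some `𝔖(w.α i)` with `w.α i` positive, and it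
has as many elements as `𝔖(α i)`. By `posMultiples_α`, the multiples of `α x` that are positive
roots are the `K • α x` with `K` a product of `ratio`s along a path of odd neighbours ending at `x`.
Such paths stay in one ON-component, so the fiber size is `fComponent` of that component. For the
symmetric matrix all ratios are `1`, so `|Φ_std⁺|` is the number of reflections. -/

namespace EGCM

/-! ### Signs and special values of the Chebyshev polynomials `S n` -/

section Chebyshev

theorem chebyshevS_eval_pos_of_two_le {t : ℝ} (ht : 2 ≤ t) (n : ℕ) :
    0 < (Polynomial.Chebyshev.S ℝ n).eval t := by
  -- Positivity alone does not pass through `S (n+2) = t * S (n+1) - S n`; monotonicity in `n` is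
  -- carried along.
  suffices h : 0 < (Polynomial.Chebyshev.S ℝ n).eval t ∧
      (Polynomial.Chebyshev.S ℝ n).eval t ≤ (Polynomial.Chebyshev.S ℝ (n + 1)).eval t from h.1
  induction n with
  | zero => simp; linarith
  | succ n ih =>
    have h := congrArg (Polynomial.eval t) (Polynomial.Chebyshev.S_add_two ℝ n)
    rw [Polynomial.eval_sub, Polynomial.eval_mul, Polynomial.eval_X] at h
    push_cast
    rw [show ((n : ℤ) + 1 + 1) = n + 2 by ring, h]
    exact ⟨by linarith [ih.1, ih.2], by nlinarith [ih.1, ih.2]⟩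

theorem sin_pi_div_pos {m : ℕ} (hm : 2 ≤ m) : 0 < Real.sin (Real.pi / m) := by
  have hm' : (2 : ℝ) ≤ m := by exact_mod_cast hm
  exact Real.sin_pos_of_pos_of_lt_pi (by positivity) (div_lt_self Real.pi_pos (by linarith))

theorem chebyshevS_eval_cos {m : ℕ} (hm : 2 ≤ m) (n : ℤ) :
    (Polynomial.Chebyshev.S ℝ n).eval (2 * Real.cos (Real.pi / m)) =
      Real.sin ((n + 1) * (Real.pi / m)) / Real.sin (Real.pi / m) := by
  rw [eq_div_iff (sin_pi_div_pos hm).ne']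
  exact Polynomial.Chebyshev.S_two_mul_real_cos _ n

theorem chebyshevS_eval_cos_pos {m n : ℕ} (h : n + 1 < m) :
    0 < (Polynomial.Chebyshev.S ℝ n).eval (2 * Real.cos (Real.pi / m)) := by
  rw [chebyshevS_eval_cos (by omega)]
  have hm' : (0 : ℝ) < m := by exact_mod_cast (by omega : 0 < m)
  refine div_pos (Real.sin_pos_of_pos_of_lt_pi ?_ ?_) (sin_pi_div_pos (by omega))
  · push_cast
    positivity
  · rw [← mul_div_assoc, div_lt_iff₀ hm', mul_comm]
    have : ((n : ℤ) : ℝ) + 1 < m := by exact_mod_cast h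
    exact mul_lt_mul_of_pos_left this Real.pi_pos

theorem chebyshevS_eval_cos_sub_one {m : ℕ} (hm : 2 ≤ m) :
    (Polynomial.Chebyshev.S ℝ (m - 1)).eval (2 * Real.cos (Real.pi / m)) = 0 := by
  have hm' : (m : ℝ) ≠ 0 := by exact_mod_cast (by omega : m ≠ 0)
  rw [chebyshevS_eval_cos hm]
  push_cast
  rw [sub_add_cancel, mul_div_cancel₀ _ hm', Real.sin_pi, zero_div]

theorem chebyshevS_eval_cos_sub_two {m : ℕ} (hm : 2 ≤ m) :
    (Polynomial.Chebyshev.S ℝ (m - 2)).eval (2 * Real.cos (Real.pi / m)) = 1 := by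
  have hm' : (m : ℝ) ≠ 0 := by exact_mod_cast (by omega : m ≠ 0)
  rw [chebyshevS_eval_cos hm]
  push_cast
  rw [show ((m : ℝ) - 2 + 1) * (Real.pi / m) = Real.pi - Real.pi / m by field_simp; ring,
    Real.sin_pi_sub, div_self (sin_pi_div_pos hm).ne']

end Chebyshev

/-! ### Simple roots and the symmetrization of a pair of indices -/

variable {I : Type*} (A : EGCM I)

/-- The Coxeter system underlying `A`. -/
noncomputable abbrev cs : CoxeterSystem A.coxeterMatrix A.W := A.coxeterMatrix.toCoxeterSystem

/-- The simple root `α i`. -/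
noncomputable abbrev α (i : I) : I →₀ ℝ := Finsupp.single i 1

theorem σ_cs_simple (i : I) : A.σ (A.cs.simple i) = A.S i := A.σ_simple i

theorem B_single (i j : I) : A.B (α i) (α j) = A.a i j / 2 := by
  simp [B]

theorem S_α (i j : I) : A.S i (α j) = α j - A.a i j • α i := by
  rw [S_apply, B_single]
  congr 2
  ring

theorem S_α_self (i : I) : A.S i (α i) = -α i := by
  rw [S_α, A.diag]
  module

/-- The square root of the product of two transpose entries. -/
noncomputable def geomMean (i j : I) : ℝ := √(A.a i j * A.a j i)

/-- The factor by which the longest alternating element mapping `α i` into the line of `α j`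
stretches it, when `m i j` is odd. -/
noncomputable def ratio (i j : I) : ℝ := if A.a i j = 0 then 1 else √(A.a j i / A.a i j)

theorem ratio_pos {i j : I} (h : i ≠ j) : 0 < A.ratio i j := by
  unfold ratio
  split_ifs with h0
  · exact one_pos
  · exact Real.sqrt_pos.2 (div_pos_of_neg_of_neg
      (lt_of_le_of_ne (A.nonpos j i h.symm) (A.ne_zero_symm i j h0))
      (lt_of_le_of_ne (A.nonpos i j h) h0))

theorem a_symm_eq_zero {i j : I} (h : A.a i j = 0) : A.a j i = 0 :=
  by_contra fun hne => A.ne_zero_symm j i hne h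

/-- Together with `a_mul_ratio`: replacing `α j` by `ratio i j • α j` turns both off-diagonal
entries of the pair into `-geomMean i j`, which reduces rank two to the symmetric case. -/
theorem a_eq_neg_geomMean_mul_ratio {i j : I} (h : i ≠ j) :
    A.a j i = -(A.geomMean i j * A.ratio i j) := by
  unfold ratio geomMean
  split_ifs with h0
  · simp [h0, A.a_symm_eq_zero h0]
  · have h1 := A.nonpos i j h
    have h2 := A.nonpos j i h.symm
    rw [← Real.sqrt_mul (mul_nonneg_of_nonpos_of_nonpos h1 h2),
      show A.a i j * A.a j i * (A.a j i / A.a i j) = A.a j i ^ 2 by field_simp,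
      Real.sqrt_sq_eq_abs, abs_of_nonpos h2, neg_neg]

theorem a_mul_ratio {i j : I} (h : i ≠ j) :
    A.a i j * A.ratio i j = -A.geomMean i j := by
  unfold ratio geomMean
  split_ifs with h0
  · simp [h0]
  · have h1 := A.nonpos i j h
    have h2 := A.nonpos j i h.symm
    have : A.a i j = -√(A.a i j ^ 2) := by
      rw [Real.sqrt_sq_eq_abs, abs_of_nonpos h1, neg_neg]
    nth_rw 1 [this]
    rw [neg_mul, ← Real.sqrt_mul (sq_nonneg _)]
    congr 2
    field_simp

theorem two_le_geomMean {i j : I} (h : i ≠ j) (hm : A.coxeterMatrix i j = 0) :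
    2 ≤ A.geomMean i j := by
  rcases A.prod_spec i j h with h4 | ⟨k, hk, he⟩
  · exact Real.le_sqrt_of_sq_le (by linarith)
  · rw [A.coxeterMatrix_of_ne h, he, orderOfProd_cos hk] at hm
    omega

theorem two_le_coxeterMatrix {i j : I} (h : i ≠ j) (hm : A.coxeterMatrix i j ≠ 0) :
    2 ≤ A.coxeterMatrix i j := by
  have := A.coxeterMatrix.off_diagonal i j h
  omega

theorem geomMean_eq {i j : I} (h : i ≠ j) (hm : A.coxeterMatrix i j ≠ 0) :
    A.geomMean i j = 2 * Real.cos (Real.pi / A.coxeterMatrix i j) := by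
  have h2 := A.two_le_coxeterMatrix h hm
  rw [A.coxeterMatrix_of_ne h] at hm h2 ⊢
  unfold geomMean
  nth_rw 1 [(orderOfProd_spec hm).2]
  have hpi := Real.pi_pos
  have h2' : (2 : ℝ) ≤ orderOfProd (A.a i j * A.a j i) := by exact_mod_cast h2
  have : 0 ≤ Real.cos (Real.pi / orderOfProd (A.a i j * A.a j i)) :=
    Real.cos_nonneg_of_neg_pi_div_two_le_of_le
      (by linarith [show 0 ≤ Real.pi / orderOfProd (A.a i j * A.a j i) by positivity]) (by gcongr)
  rw [show ∀ x : ℝ, 4 * x ^ 2 = (2 * x) ^ 2 by intro x; ring, Real.sqrt_sq (by linarith)]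

theorem chebyshevS_geomMean_pos {i j : I} (h : i ≠ j) {n : ℕ}
    (hn : A.coxeterMatrix i j = 0 ∨ n + 1 < A.coxeterMatrix i j) :
    0 < (Polynomial.Chebyshev.S ℝ n).eval (A.geomMean i j) := by
  by_cases hm : A.coxeterMatrix i j = 0
  · exact chebyshevS_eval_pos_of_two_le (A.two_le_geomMean h hm) n
  · rw [A.geomMean_eq h hm]
    exact chebyshevS_eval_cos_pos (hn.resolve_left hm)

theorem chebyshevS_geomMean_sub_one {i j : I} (h : i ≠ j) (hm : A.coxeterMatrix i j ≠ 0) :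
    (Polynomial.Chebyshev.S ℝ (A.coxeterMatrix i j - 1)).eval (A.geomMean i j) = 0 := by
  rw [A.geomMean_eq h hm]
  exact chebyshevS_eval_cos_sub_one (A.two_le_coxeterMatrix h hm)

theorem chebyshevS_geomMean_sub_two {i j : I} (h : i ≠ j) (hm : A.coxeterMatrix i j ≠ 0) :
    (Polynomial.Chebyshev.S ℝ (A.coxeterMatrix i j - 2)).eval (A.geomMean i j) = 1 := by
  rw [A.geomMean_eq h hm]
  exact chebyshevS_eval_cos_sub_two (A.two_le_coxeterMatrix h hm)

/-! ### Alternating elements, the rank two reduction and signs of roots -/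

open CoxeterSystem (alternatingWord alternatingWord_succ alternatingWord_succ')

/-- The action of the alternating elements of a rank two parabolic subgroup on a simple root. -/
theorem σ_alternatingWord_α {i j : I} (h : i ≠ j) (k : ℕ) :
    A.σ (A.cs.wordProd (alternatingWord i j k)) (α i) =
      if Even k then
        (Polynomial.Chebyshev.S ℝ k).eval (A.geomMean i j) • α i +
          (A.ratio i j * (Polynomial.Chebyshev.S ℝ (k - 1)).eval (A.geomMean i j)) • α j
      else
        (Polynomial.Chebyshev.S ℝ (k - 1)).eval (A.geomMean i j) • α i +
          (A.ratio i j * (Polynomial.Chebyshev.S ℝ k).eval (A.geomMean i j)) • α j := by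
  induction k with
  | zero => simp [alternatingWord]
  | succ k ih =>
    -- A further reflection changes one coordinate only, replacing `S (k-1)` by `geomMean * S k - S
    -- (k-1)`, which is `S (k+1)`.
    have hrec := congrArg (Polynomial.eval (A.geomMean i j))
      (Polynomial.Chebyshev.S_add_two ℝ ((k : ℤ) - 1))
    rw [Polynomial.eval_sub, Polynomial.eval_mul, Polynomial.eval_X,
      show (k : ℤ) - 1 + 2 = k + 1 by ring, sub_add_cancel] at hrec
    have h1 := A.a_mul_ratio h
    have h2 := A.a_eq_neg_geomMean_mul_ratio h
    rw [alternatingWord_succ', A.cs.wordProd_cons, map_mul, LinearEquiv.mul_apply, ih]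
    push_cast
    rw [add_sub_cancel_right, hrec]
    by_cases hk : Even k
    · have hk' : ¬ Even (k + 1) := by simpa [Nat.even_add_one] using hk
      rw [if_pos hk, if_pos hk, if_neg hk', σ_cs_simple, map_add, map_smul, map_smul, S_α_self,
        S_α, h2]
      module
    · have hk' : Even (k + 1) := by simpa [Nat.even_add_one] using hk
      rw [if_neg hk, if_neg hk, if_pos hk', σ_cs_simple, map_add, map_smul, map_smul, S_α_self,
        S_α]
      match_scalars
      · linear_combination
          (-(Polynomial.Chebyshev.S ℝ (k : ℤ)).eval (A.geomMean i j)) * h1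
      · ring

/-- Splitting off a maximal alternating right factor in `i` and `j` from an element with right
descent `j` but not `i`. -/
theorem exists_eq_mul_alternatingWord {w : A.W} {i j : I}
    (hi : ¬ A.cs.IsRightDescent w i) (hj : A.cs.IsRightDescent w j) :
    ∃ (v : A.W) (k : ℕ), 1 ≤ k ∧ w = v * A.cs.wordProd (alternatingWord i j k) ∧
      A.cs.length w = A.cs.length v + k ∧ ¬ A.cs.IsRightDescent v i ∧
      ¬ A.cs.IsRightDescent v j ∧ (A.coxeterMatrix i j = 0 ∨ k < A.coxeterMatrix i j) := by
  classical
  let P : ℕ → Prop := fun k => ∃ v : A.W, w = v * A.cs.wordProd (alternatingWord i j k) ∧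
    A.cs.length w = A.cs.length v + k
  have hP1 : P 1 := by
    refine ⟨w * A.cs.simple j, (A.cs.simple_mul_simple_cancel_right j).symm, ?_⟩
    exact (A.cs.isRightDescent_iff.1 hj).symm
  have hPle : ∀ k, P k → k ≤ A.cs.length w := fun k ⟨v, _, hv⟩ => by omega
  obtain ⟨v, hw, hl⟩ : P (Nat.findGreatest P (A.cs.length w)) :=
    Nat.findGreatest_spec (hPle 1 hP1) hP1
  have hk1 := Nat.le_findGreatest (hPle 1 hP1) hP1
  have hmax : ¬ P (Nat.findGreatest P (A.cs.length w) + 1) := fun h => by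
    have := Nat.le_findGreatest (hPle _ h) h
    omega
  generalize Nat.findGreatest P (A.cs.length w) = k at hw hl hk1 hmax
  -- A descent at the next letter would lengthen the maximal alternating factor.
  have hnext : ¬ A.cs.IsRightDescent v (if Even k then j else i) := fun h => by
    refine hmax ⟨v * A.cs.simple (if Even k then j else i), ?_, ?_⟩
    · rw [alternatingWord_succ', A.cs.wordProd_cons, mul_assoc,
        A.cs.simple_mul_simple_cancel_left, hw]
    · have := A.cs.isRightDescent_iff.1 h
      omega
  obtain ⟨k, rfl⟩ : ∃ l, k = l + 1 := ⟨k - 1, by omega⟩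
  -- A descent at the letter split off last would cancel against it and make `w` too short.
  have hprev : ¬ A.cs.IsRightDescent v (if Even k then j else i) := fun h => by
    rw [alternatingWord_succ', A.cs.wordProd_cons, ← mul_assoc] at hw
    have h1 := A.cs.length_mul_le (v * A.cs.simple (if Even k then j else i))
      (A.cs.wordProd (alternatingWord i j k))
    have h2 := A.cs.length_wordProd_le (alternatingWord i j k)
    rw [CoxeterSystem.length_alternatingWord] at h2
    rw [← hw] at h1
    have := A.cs.isRightDescent_iff.1 h
    omega
  have hij : ¬ A.cs.IsRightDescent v i ∧ ¬ A.cs.IsRightDescent v j := by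
    by_cases hk : Even k <;> simp_all [Nat.even_add_one]
  refine ⟨v, k + 1, hk1, hw, hl, hij.1, hij.2, ?_⟩
  -- The factor is reduced, so its length cannot exceed `m i j`; if equal to `m i j`, the braid
  -- relation lets it end in `i`, making `i` a right descent of `w`.
  by_contra! hcon
  obtain ⟨hm, hle⟩ := hcon
  have hred : A.cs.length (A.cs.wordProd (alternatingWord i j (k + 1))) = k + 1 := by
    have h1 := A.cs.length_mul_le v (A.cs.wordProd (alternatingWord i j (k + 1)))
    have h2 := A.cs.length_wordProd_le (alternatingWord i j (k + 1))
    rw [CoxeterSystem.length_alternatingWord] at h2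
    rw [← hw] at h1
    omega
  have hkm : k + 1 = A.coxeterMatrix i j := by
    by_contra hne
    refine A.cs.not_isReduced_alternatingWord i j hm (m := k + 1) (by omega) ?_
    rw [CoxeterSystem.IsReduced, hred, CoxeterSystem.length_alternatingWord]
  have hbraid : A.cs.wordProd (alternatingWord i j (k + 1)) =
      A.cs.wordProd (alternatingWord j i (k + 1)) := by
    have := A.cs.wordProd_braidWord_eq i j
    rwa [CoxeterSystem.braidWord, CoxeterSystem.braidWord, A.coxeterMatrix.symmetric j i,
      ← hkm] at this
  apply hi
  rw [hbraid, alternatingWord_succ, A.cs.wordProd_concat, ← mul_assoc] at hw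
  rw [CoxeterSystem.IsRightDescent, hw, A.cs.simple_mul_simple_cancel_right, ← hw]
  have h1 := A.cs.length_mul_le v (A.cs.wordProd (alternatingWord i j k))
  have h2 := A.cs.length_wordProd_le (alternatingWord i j k)
  rw [CoxeterSystem.length_alternatingWord] at h2
  omega

/-- The rank two reduction: the image of `α i` under `w` in terms of a shorter element. -/
theorem exists_reduction {w : A.W} {i : I} (hi : ¬ A.cs.IsRightDescent w i) (hw : w ≠ 1) :
    ∃ (v : A.W) (j : I) (c d : ℝ), i ≠ j ∧ A.cs.length v < A.cs.length w ∧
      ¬ A.cs.IsRightDescent v i ∧ ¬ A.cs.IsRightDescent v j ∧ 0 ≤ c ∧ 0 ≤ d ∧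
      A.σ w (α i) = c • A.σ v (α i) + d • A.σ v (α j) ∧
      (c = 0 → Odd (A.coxeterMatrix i j) ∧ d = A.ratio i j) ∧ (d = 0 → c = 1) := by
  obtain ⟨j, hj⟩ := A.cs.exists_rightDescent_of_ne_one hw
  have hij : i ≠ j := fun h => hi (h ▸ hj)
  obtain ⟨v, k, hk, hwv, hl, hvi, hvj, hm⟩ := A.exists_eq_mul_alternatingWord hi hj
  have hact : A.σ w (α i) =
      A.σ v (A.σ (A.cs.wordProd (alternatingWord i j k)) (α i)) := by
    rw [hwv, map_mul, LinearEquiv.mul_apply]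
  rw [A.σ_alternatingWord_α hij] at hact
  have hr := A.ratio_pos hij
  obtain ⟨k, rfl⟩ : ∃ l, k = l + 1 := ⟨k - 1, by omega⟩
  push_cast at hact
  rw [add_sub_cancel_right] at hact
  have hpos : 0 < (Polynomial.Chebyshev.S ℝ k).eval (A.geomMean i j) :=
    A.chebyshevS_geomMean_pos hij hm
  -- The alternating factor now has length `k + 1`. A coefficient vanishes only at length `m i j -
  -- 1`; the other Chebyshev value is then `1`, and the parity of `m i j` decides which of `c`, `d`
  -- is zero.
  have hlast : 0 < (Polynomial.Chebyshev.S ℝ (k + 1)).eval (A.geomMean i j) ∨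
      (Polynomial.Chebyshev.S ℝ (k + 1)).eval (A.geomMean i j) = 0 ∧
      (Polynomial.Chebyshev.S ℝ k).eval (A.geomMean i j) = 1 ∧
      k + 2 = A.coxeterMatrix i j := by
    by_cases hm0 : A.coxeterMatrix i j = 0
    · exact Or.inl (A.chebyshevS_geomMean_pos hij (n := k + 1) (Or.inl hm0))
    · by_cases hk2 : k + 2 = A.coxeterMatrix i j
      · right
        have h1 := A.chebyshevS_geomMean_sub_one hij hm0
        have h2 := A.chebyshevS_geomMean_sub_two hij hm0
        rw [← hk2] at h1 h2
        push_cast at h1 h2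
        rw [show (k : ℤ) + 2 - 1 = k + 1 by ring] at h1
        rw [add_sub_cancel_right] at h2
        exact ⟨h1, h2, hk2⟩
      · exact Or.inl (A.chebyshevS_geomMean_pos hij (n := k + 1) (Or.inr (by omega)))
  generalize (Polynomial.Chebyshev.S ℝ k).eval (A.geomMean i j) = x at *
  generalize (Polynomial.Chebyshev.S ℝ (k + 1)).eval (A.geomMean i j) = y at *
  have hy : 0 ≤ y := by rcases hlast with h | h <;> linarith
  have hlt : A.cs.length v < A.cs.length w := by omega
  by_cases hpar : Even (k + 1)
  · rw [if_pos hpar, map_add, map_smul, map_smul] at hact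
    refine ⟨v, j, y, A.ratio i j * x, hij, hlt, hvi, hvj, hy, by positivity, hact, ?_, ?_⟩
    · intro h0
      rcases hlast with h | ⟨-, h1, h2⟩
      · exact absurd h0 h.ne'
      · rw [h1, mul_one, ← h2]
        exact ⟨hpar.add_one, rfl⟩
    · intro h0
      exact absurd h0 (by positivity)
  · rw [if_neg hpar, map_add, map_smul, map_smul] at hact
    refine ⟨v, j, x, A.ratio i j * y, hij, hlt, hvi, hvj, hpos.le, by positivity, hact, ?_, ?_⟩
    · intro h0
      exact absurd h0 hpos.ne'
    · intro h0
      rcases hlast with h | ⟨-, h1, -⟩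
      · exact absurd h0 (by positivity)
      · exact h1

/-- Induction on length: the reduction gives a nonnegative combination of images under a shorter
element that again lacks the relevant descents. -/
theorem σ_α_nonneg {w : A.W} {i : I} (hi : ¬ A.cs.IsRightDescent w i) (x : I) :
    0 ≤ A.σ w (α i) x := by
  induction hn : A.cs.length w using Nat.strong_induction_on generalizing w i with
  | _ n ih =>
    by_cases hw : w = 1
    · subst hw
      rw [map_one, LinearEquiv.coe_one, id_eq]
      exact (Finsupp.single_nonneg.2 zero_le_one) x
    · obtain ⟨v, j, c, d, -, hl, hvi, hvj, hc, hd, he, -⟩ := A.exists_reduction hi hw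
      rw [he]
      have h1 := ih _ (hn ▸ hl) hvi rfl
      have h2 := ih _ (hn ▸ hl) hvj rfl
      simp only [Finsupp.add_apply, Finsupp.smul_apply, smul_eq_mul]
      positivity

theorem σ_mul_simple_α (w : A.W) (i : I) :
    A.σ (w * A.cs.simple i) (α i) = -A.σ w (α i) := by
  rw [map_mul, LinearEquiv.mul_apply, σ_cs_simple, S_α_self, map_neg]

theorem σ_α_nonpos {w : A.W} {i : I} (hi : A.cs.IsRightDescent w i) (x : I) :
    A.σ w (α i) x ≤ 0 := by
  have h := A.σ_α_nonneg (A.cs.isRightDescent_iff_not_isRightDescent_mul.1 hi) x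
  rw [σ_mul_simple_α, Finsupp.neg_apply] at h
  linarith

theorem σ_α_ne_zero (w : A.W) (i : I) : A.σ w (α i) ≠ 0 := by
  rw [Ne, LinearEquiv.map_eq_zero_iff]
  exact Finsupp.single_ne_zero.2 one_ne_zero

theorem not_isRightDescent_of_nonneg {w : A.W} {i : I} (h : ∀ x, 0 ≤ A.σ w (α i) x) :
    ¬ A.cs.IsRightDescent w i := fun hd =>
  A.σ_α_ne_zero w i (Finsupp.ext fun x => le_antisymm (A.σ_α_nonpos hd x) (h x))

theorem σ_injective : Function.Injective A.σ := by
  rw [injective_iff_map_eq_one]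
  intro w hw
  by_contra hne
  obtain ⟨i, hi⟩ := A.cs.exists_rightDescent_of_ne_one hne
  have := A.σ_α_nonpos hi i
  rw [hw, LinearEquiv.coe_one, id_eq, Finsupp.single_eq_same] at this
  linarith

/-! ### Paths of odd neighbours and roots on the line of a simple root -/

/-- `A.OddPath i j K` means that there is a path of odd neighbours from `i` to `j` along which the
factors `ratio` multiply to `K`. -/
inductive OddPath : I → I → ℝ → Prop
  | refl (i : I) : OddPath i i 1
  | step {i j l : I} {K : ℝ} (h : A.onGraph.Adj i j) (p : OddPath j l K) :
      OddPath i l (A.ratio i j * K)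

variable {A} in
theorem OddPath.reachable {i j : I} {K : ℝ} (p : A.OddPath i j K) : A.onGraph.Reachable i j := by
  induction p with
  | refl => rfl
  | step h _ ih => exact h.reachable.trans ih

variable {A} in
theorem OddPath.pos {i j : I} {K : ℝ} (p : A.OddPath i j K) : 0 < K := by
  induction p with
  | refl => exact one_pos
  | step h _ ih => exact mul_pos (A.ratio_pos h.1) ih

theorem exists_oddPath {i j : I} (h : A.onGraph.Reachable i j) : ∃ K, A.OddPath i j K := by
  obtain ⟨p⟩ := h
  induction p with
  | nil => exact ⟨1, .refl _⟩
  | cons h _ ih =>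
    obtain ⟨K, hK⟩ := ih
    exact ⟨_, .step h hK⟩

/-- The alternating element of even length `m i j - 1` works, since there the Chebyshev coefficients
are `0` and `1`. -/
theorem exists_σ_α_of_adj {i j : I} (h : A.onGraph.Adj i j) :
    ∃ w : A.W, A.σ w (α i) = A.ratio i j • α j := by
  have hm0 : A.coxeterMatrix i j ≠ 0 := h.2.pos.ne'
  have h2 := A.two_le_coxeterMatrix h.1 hm0
  have hev : Even (A.coxeterMatrix i j - 1) := Nat.Odd.sub_odd h.2 odd_one
  refine ⟨A.cs.wordProd (alternatingWord i j (A.coxeterMatrix i j - 1)), ?_⟩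
  rw [A.σ_alternatingWord_α h.1, if_pos hev]
  push_cast [show 1 ≤ A.coxeterMatrix i j by omega]
  rw [A.chebyshevS_geomMean_sub_one h.1 hm0,
    show (A.coxeterMatrix i j : ℤ) - 1 - 1 = A.coxeterMatrix i j - 2 by ring,
    A.chebyshevS_geomMean_sub_two h.1 hm0]
  simp

variable {A} in
theorem OddPath.exists_σ_α {i j : I} {K : ℝ} (p : A.OddPath i j K) :
    ∃ w : A.W, A.σ w (α i) = K • α j := by
  induction p with
  | refl => exact ⟨1, by simp⟩
  | step h _ ih =>
    obtain ⟨v, hv⟩ := ih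
    obtain ⟨w, hw⟩ := A.exists_σ_α_of_adj h
    exact ⟨v * w, by rw [map_mul, LinearEquiv.mul_apply, hw, map_smul, hv, smul_smul]⟩

/-- A coordinate axis is an extreme ray of the nonnegative orthant. -/
theorem eq_smul_single_of_add_eq {c d K : ℝ} (hc : 0 < c) (hd : 0 ≤ d) {u v : I →₀ ℝ} {x : I}
    (hu : ∀ y, 0 ≤ u y) (hv : ∀ y, 0 ≤ v y) (h : c • u + d • v = K • α x) :
    u = u x • α x := by
  ext y
  by_cases hy : y = x
  · subst hy
    simp
  · have := DFunLike.congr_fun h y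
    have h1 : (α x) y = 0 := Finsupp.single_eq_of_ne hy
    simp only [Finsupp.add_apply, Finsupp.smul_apply, smul_eq_mul, h1, mul_zero] at this ⊢
    have h2 := mul_nonneg hd (hv y)
    have h3 := mul_nonneg hc.le (hu y)
    exact (mul_eq_zero.1 (by linarith)).resolve_left hc.ne'

/-- Converse of `OddPath.exists_σ_α`, by induction on length. In the rank two reduction, `c = 0`
contributes one odd step and `d = 0` none. -/
theorem oddPath_of_σ_α {w : A.W} {i x : I} {K : ℝ} (hK : 0 < K)
    (h : A.σ w (α i) = K • α x) : A.OddPath i x K := by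
  induction hn : A.cs.length w using Nat.strong_induction_on generalizing w i K with
  | _ n ih =>
    have hi : ¬ A.cs.IsRightDescent w i := A.not_isRightDescent_of_nonneg fun y => by
      rw [h]
      exact mul_nonneg hK.le ((Finsupp.single_nonneg.2 zero_le_one) y)
    by_cases hw : w = 1
    · subst hw
      rw [map_one, LinearEquiv.coe_one, id_eq] at h
      have hix : i = x := by
        by_contra hne
        have := DFunLike.congr_fun h i
        rw [Finsupp.single_eq_same, Finsupp.smul_apply, Finsupp.single_eq_of_ne hne] at this
        simp at this
      subst hix
      have := DFunLike.congr_fun h i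
      simp only [Finsupp.single_eq_same, Finsupp.smul_apply, smul_eq_mul, mul_one] at this
      rw [← this]
      exact .refl i
    · obtain ⟨v, j, c, d, hij, hl, hvi, hvj, hc, hd, he, hc0, hd0⟩ := A.exists_reduction hi hw
      rw [h] at he
      rcases hc.eq_or_lt with hc' | hc'
      · obtain ⟨hodd, rfl⟩ := hc0 hc'.symm
        have hr := A.ratio_pos hij
        rw [← hc', zero_smul, zero_add] at he
        have hv : A.σ v (α j) = (K / A.ratio i j) • α x := by
          rw [div_eq_inv_mul, mul_smul, he, smul_smul, inv_mul_cancel₀ hr.ne', one_smul]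
        have := OddPath.step (A := A) ⟨hij, hodd⟩ (ih _ (hn ▸ hl) (div_pos hK hr) hv rfl)
        rwa [mul_div_cancel₀ _ hr.ne'] at this
      · rcases hd.eq_or_lt with hd' | hd'
        · rw [← hd', zero_smul, add_zero, hd0 hd'.symm, one_smul] at he
          exact ih _ (hn ▸ hl) hK he.symm rfl
        -- With both coefficients positive, extremality puts the images of `α i` and `α j` on one
        -- line, against injectivity of `σ v`.
        · exfalso
          have h1 := eq_smul_single_of_add_eq hc' hd (A.σ_α_nonneg hvi) (A.σ_α_nonneg hvj) he.symm
          have h2 := eq_smul_single_of_add_eq hd' hc (A.σ_α_nonneg hvj) (A.σ_α_nonneg hvi)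
            ((add_comm _ _).trans he.symm)
          generalize A.σ v (α i) x = a at h1
          generalize A.σ v (α j) x = b at h2
          have ha : a ≠ 0 := fun h0 => A.σ_α_ne_zero v i (by rw [h1, h0, zero_smul])
          have h3 : A.σ v (b • α i) = A.σ v (a • α j) := by
            rw [map_smul, map_smul, h1, h2, smul_comm]
          have h4 := DFunLike.congr_fun ((A.σ v).injective h3) j
          rw [Finsupp.smul_apply, Finsupp.smul_apply, Finsupp.single_eq_same,
            Finsupp.single_eq_of_ne hij.symm] at h4
          simp at h4
          exact ha h4.symm

/-! ### Positive multiples of a root -/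

theorem α_nonneg (i x : I) : 0 ≤ α i x := (Finsupp.single_nonneg.2 zero_le_one) x

theorem α_ne_zero (i : I) : α i ≠ 0 := Finsupp.single_ne_zero.2 one_ne_zero

theorem σ_mem_roots {v : I →₀ ℝ} (hv : v ∈ A.roots) (w : A.W) : A.σ w v ∈ A.roots := by
  obtain ⟨u, i, rfl⟩ := hv
  exact ⟨w * u, i, by rw [map_mul, LinearEquiv.mul_apply]⟩

theorem σ_inv_σ (w : A.W) (v : I →₀ ℝ) : A.σ w⁻¹ (A.σ w v) = v := by
  rw [← LinearEquiv.mul_apply, ← map_mul, inv_mul_cancel, map_one, LinearEquiv.coe_one, id_eq]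

theorem σ_σ_inv (w : A.W) (v : I →₀ ℝ) : A.σ w (A.σ w⁻¹ v) = v := by
  rw [← LinearEquiv.mul_apply, ← map_mul, mul_inv_cancel, map_one, LinearEquiv.coe_one, id_eq]

theorem finite_roots [Finite I] [Finite A.W] : A.roots.Finite := by
  refine (Set.finite_range fun p : A.W × I => A.σ p.1 (α p.2)).subset ?_
  rintro v ⟨w, i, rfl⟩
  exact ⟨(w, i), rfl⟩

theorem finite_posRoots [Finite I] [Finite A.W] : A.posRoots.Finite :=
  A.finite_roots.subset fun _ h => h.1

/-- Expressing positivity by `K > 0` instead of by coordinates gives a description that `W`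
transports. -/
theorem posMultiples_eq {u : I →₀ ℝ} (h0 : u ≠ 0) (hu : ∀ i, 0 ≤ u i) :
    A.posMultiples u = {v | v ∈ A.roots ∧ ∃ K : ℝ, 0 < K ∧ v = K • u} := by
  ext v
  constructor
  · rintro ⟨⟨hv, hv0⟩, K, rfl⟩
    refine ⟨hv, K, ?_, rfl⟩
    obtain ⟨i, hi⟩ := Finsupp.ne_iff.1 h0
    have hi' : 0 < u i := lt_of_le_of_ne (hu i) (Ne.symm hi)
    have hK : 0 ≤ K := nonneg_of_mul_nonneg_left (hv0 i) hi'
    refine lt_of_le_of_ne hK fun hK0 => ?_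
    obtain ⟨w, j, hw⟩ := hv
    exact A.σ_α_ne_zero w j (by rw [← hw, ← hK0, zero_smul])
  · rintro ⟨hv, K, hK, rfl⟩
    exact ⟨⟨hv, fun i => mul_nonneg hK.le (hu i)⟩, K, rfl⟩

theorem posMultiples_smul {u : I →₀ ℝ} {c : ℝ} (hc : c ≠ 0) :
    A.posMultiples (c • u) = A.posMultiples u := by
  ext v
  constructor
  · rintro ⟨hv, K, rfl⟩
    exact ⟨hv, K * c, smul_smul _ _ _⟩
  · rintro ⟨hv, K, rfl⟩
    exact ⟨hv, K / c, by rw [smul_smul, div_mul_cancel₀ _ hc]⟩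

theorem ncard_posMultiples_σ {u : I →₀ ℝ} {w : A.W} (h0 : u ≠ 0) (hu : ∀ i, 0 ≤ u i)
    (hw : ∀ i, 0 ≤ A.σ w u i) :
    (A.posMultiples (A.σ w u)).ncard = (A.posMultiples u).ncard := by
  rw [← Set.ncard_image_of_injective (A.posMultiples u) (A.σ w).injective, A.posMultiples_eq h0 hu,
    A.posMultiples_eq ((LinearEquiv.map_ne_zero_iff _).2 h0) hw]
  congr 1
  ext v
  constructor
  · rintro ⟨hv, K, hK, rfl⟩
    refine ⟨K • u, ⟨?_, K, hK, rfl⟩, map_smul _ _ _⟩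
    have := A.σ_mem_roots hv w⁻¹
    rwa [map_smul, σ_inv_σ] at this
  · rintro ⟨_, ⟨hv, K, hK, rfl⟩, rfl⟩
    exact ⟨A.σ_mem_roots hv w, K, hK, map_smul _ _ _⟩

theorem posMultiples_α (x : I) :
    A.posMultiples (α x) = (fun K : ℝ => K • α x) '' {K | ∃ j, A.OddPath j x K} := by
  rw [A.posMultiples_eq (α_ne_zero x) (α_nonneg x)]
  ext v
  constructor
  · rintro ⟨⟨w, j, hw⟩, K, hK, rfl⟩
    exact ⟨K, ⟨j, A.oddPath_of_σ_α hK hw.symm⟩, rfl⟩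
  · rintro ⟨K, ⟨j, p⟩, rfl⟩
    obtain ⟨w, hw⟩ := p.exists_σ_α
    exact ⟨⟨w, j, hw.symm⟩, K, p.pos, rfl⟩

theorem smul_α_injective (x : I) : Function.Injective fun K : ℝ => K • α x :=
  smul_left_injective ℝ (α_ne_zero x)

theorem ncard_posMultiples_of_reachable {x y : I} (h : A.onGraph.Reachable x y) :
    (A.posMultiples (α x)).ncard = (A.posMultiples (α y)).ncard := by
  obtain ⟨K, p⟩ := A.exists_oddPath h
  obtain ⟨w, hw⟩ := p.exists_σ_α
  rw [← A.posMultiples_smul (u := α y) p.pos.ne', ← hw]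
  refine (A.ncard_posMultiples_σ (α_ne_zero x) (α_nonneg x) fun i => ?_).symm
  rw [hw]
  exact mul_nonneg p.pos.le (α_nonneg y i)

/-! ### Comparison with the ON-components -/

section restrict

variable {A} {J : Set I}

theorem restrict_coxeterMatrix (i j : J) :
    (A.restrict J).coxeterMatrix i j = A.coxeterMatrix i j := by
  by_cases h : i = j
  · subst h
    rw [CoxeterMatrix.diagonal, CoxeterMatrix.diagonal]
  · rw [coxeterMatrix_of_ne _ h, coxeterMatrix_of_ne _ fun e => h (Subtype.ext e)]
    rfl

theorem restrict_onGraph_adj {i j : J} :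
    (A.restrict J).onGraph.Adj i j ↔ A.onGraph.Adj i j := by
  simp only [onGraph, restrict_coxeterMatrix, Ne, Subtype.ext_iff]

theorem OddPath.of_restrict {i j : J} {K : ℝ} (p : (A.restrict J).OddPath i j K) :
    A.OddPath i j K := by
  induction p with
  | refl i => exact .refl _
  | step h _ ih => exact .step (restrict_onGraph_adj.1 h) ih

theorem OddPath.to_component {C : A.onGraph.ConnectedComponent} {i j : I} {K : ℝ}
    (p : A.OddPath i j K) (hj : j ∈ C.supp) :
    ∃ hi : i ∈ C.supp, (A.component C).OddPath ⟨i, hi⟩ ⟨j, hj⟩ K := by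
  induction p with
  | refl i => exact ⟨hj, .refl _⟩
  | step h _ ih =>
    obtain ⟨hi, q⟩ := ih hj
    have hmem := (C.mem_supp_congr_adj h).2 hi
    exact ⟨hmem, .step (i := ⟨_, hmem⟩) (restrict_onGraph_adj.2 h) q⟩

theorem setOf_oddPath_component (C : A.onGraph.ConnectedComponent) (x : C.supp) :
    {K | ∃ j, (A.component C).OddPath j x K} = {K | ∃ j, A.OddPath j x K} := by
  ext K
  constructor
  · rintro ⟨j, p⟩
    exact ⟨j, p.of_restrict⟩
  · rintro ⟨j, p⟩
    obtain ⟨hj, q⟩ := p.to_component x.2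
    exact ⟨_, q⟩

/-- Both sides count the same set of path factors, so the two Coxeter groups need not be compared.
-/
theorem ncard_posMultiples_component (C : A.onGraph.ConnectedComponent) (x : C.supp) :
    ((A.component C).posMultiples (α x)).ncard = (A.posMultiples (α (x : I))).ncard := by
  rw [posMultiples_α, posMultiples_α, Set.ncard_image_of_injective _ (smul_α_injective x),
    Set.ncard_image_of_injective _ (smul_α_injective _), setOf_oddPath_component]

theorem finite_posMultiples_component [Finite I] [Finite A.W]
    (C : A.onGraph.ConnectedComponent) (x : C.supp) :
    ((A.component C).posMultiples (α x)).Finite := by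
  have h : (A.posMultiples (α (x : I))).Finite := A.finite_posRoots.subset fun _ h => h.1
  rw [posMultiples_α] at h ⊢
  rw [setOf_oddPath_component]
  exact (h.of_finite_image (smul_α_injective _).injOn).image _

theorem ncard_posMultiples_of_mem_supp (C : A.onGraph.ConnectedComponent) (x : C.supp) :
    (A.posMultiples (α (x : I))).ncard = A.fComponent C := by
  have : Nonempty C.supp := C.nonempty_supp.to_subtype
  have h := C.reachable_of_mem_supp x.2 (Classical.arbitrary C.supp).2
  rw [A.ncard_posMultiples_of_reachable h, ← ncard_posMultiples_component]
  rfl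

end restrict

/-! ### Symmetric matrices -/

section symmetric

variable {A}

theorem OddPath.eq_one_of_symmetric (hA : ∀ i j, A.a i j = A.a j i) {i j : I} {K : ℝ}
    (p : A.OddPath i j K) : K = 1 := by
  induction p with
  | refl => rfl
  | step h _ ih =>
    rw [ih, mul_one]
    unfold ratio
    split_ifs with h0
    · rfl
    · rw [hA, div_self h0, Real.sqrt_one]

theorem ncard_posMultiples_of_symmetric (hA : ∀ i j, A.a i j = A.a j i) (x : I) :
    (A.posMultiples (α x)).ncard = 1 := by
  have : {K | ∃ j, A.OddPath j x K} = {1} := by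
    ext K
    exact ⟨fun ⟨j, p⟩ => p.eq_one_of_symmetric hA, fun h => h ▸ ⟨x, .refl x⟩⟩
  rw [posMultiples_α, this, Set.image_singleton, Set.ncard_singleton]

end symmetric

theorem std_symm (i j : I) : A.std.a i j = A.std.a j i := by
  simp only [std, A.coxeterMatrix.symmetric j i]

/-! ### Reflections of roots and the count -/

theorem σ_conj_simple (w : A.W) (i : I) (v : I →₀ ℝ) :
    A.σ (w * A.cs.simple i * w⁻¹) v =
      v - (2 * A.B (α i) (A.σ w⁻¹ v)) • A.σ w (α i) := by
  rw [map_mul, map_mul, LinearEquiv.mul_apply, LinearEquiv.mul_apply, σ_cs_simple, S_apply,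
    map_sub, map_smul, σ_σ_inv]

/-- Powers of `g` send `v` to `v + n c u`; finite order forces `c = 0`, and the representation is
faithful. -/
theorem eq_one_of_transvection [Finite A.W] {g : A.W} {u : I →₀ ℝ} (hu0 : u ≠ 0)
    (hu : A.σ g u = u) (h : ∀ v, ∃ c : ℝ, A.σ g v = v + c • u) : g = 1 := by
  apply A.σ_injective
  rw [map_one]
  ext1 v
  obtain ⟨c, hc⟩ := h v
  have hpow : ∀ n : ℕ, A.σ (g ^ n) v = v + (n * c) • u := by
    intro n
    induction n with
    | zero => simp
    | succ n ih =>
      rw [pow_succ', map_mul, LinearEquiv.mul_apply, ih, map_add, map_smul, hu, hc]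
      push_cast
      module
  have h1 := hpow (orderOf g)
  rw [pow_orderOf_eq_one, map_one, LinearEquiv.coe_one, id_eq, left_eq_add,
    smul_eq_zero, or_iff_left hu0, mul_eq_zero, Nat.cast_eq_zero,
    or_iff_right (orderOf_pos g).ne'] at h1
  rw [hc, h1, zero_smul, add_zero, LinearEquiv.coe_one, id_eq]

/-- As `B` need not be `W`-invariant, reflections along proportional roots might a priori have
different hyperplanes. Their product fixes the common line and acts trivially modulo it, so it is a
transvection, hence trivial. -/
theorem conj_simple_eq_of_smul [Finite A.W] {w w' : A.W} {i j : I} {K : ℝ}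
    (h : A.σ w (α i) = K • A.σ w' (α j)) :
    w * A.cs.simple i * w⁻¹ = w' * A.cs.simple j * w'⁻¹ := by
  have hK : K ≠ 0 := fun h0 => A.σ_α_ne_zero w i (by rw [h, h0, zero_smul])
  have hinv : (w' * A.cs.simple j * w'⁻¹)⁻¹ = w' * A.cs.simple j * w'⁻¹ := by
    rw [mul_inv_rev, mul_inv_rev, inv_inv, A.cs.inv_simple, mul_assoc]
  rw [← mul_inv_eq_one, hinv]
  have hrefl : ∀ (w : A.W) (i : I), A.σ (w * A.cs.simple i * w⁻¹) (A.σ w (α i)) =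
      -A.σ w (α i) := fun w i => by
    rw [σ_conj_simple, σ_inv_σ, B_single, A.diag]
    module
  have h' : A.σ w' (α j) = K⁻¹ • A.σ w (α i) := by
    rw [h, smul_smul, inv_mul_cancel₀ hK, one_smul]
  refine A.eq_one_of_transvection (A.σ_α_ne_zero w' j) ?_ fun v => ?_
  · rw [map_mul, LinearEquiv.mul_apply, hrefl, map_neg]
    nth_rw 1 [h']
    rw [map_smul, hrefl, h', smul_neg, neg_neg]
  · rw [map_mul, LinearEquiv.mul_apply, A.σ_conj_simple w', A.σ_conj_simple w, h, smul_smul]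
    refine ⟨?_, ?_⟩
    rotate_left
    · rw [sub_sub, sub_eq_add_neg, ← add_smul, ← neg_smul]

/-- The reflection along a root (and `1` for any other vector). -/
noncomputable def reflectionOf (v : I →₀ ℝ) : A.W :=
  open Classical in
  if h : v ∈ A.roots then h.choose * A.cs.simple h.choose_spec.choose * h.choose⁻¹ else 1

theorem exists_reflectionOf_eq {v : I →₀ ℝ} (h : v ∈ A.roots) :
    ∃ w i, v = A.σ w (α i) ∧ A.reflectionOf v = w * A.cs.simple i * w⁻¹ :=
  ⟨h.choose, h.choose_spec.choose, h.choose_spec.choose_spec, dif_pos h⟩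

theorem reflectionOf_eq_iff [Finite A.W] {v : I →₀ ℝ} (hv : v ∈ A.roots) (w : A.W) (i : I) :
    A.reflectionOf v = w * A.cs.simple i * w⁻¹ ↔ ∃ K : ℝ, v = K • A.σ w (α i) := by
  obtain ⟨w', j, rfl, h⟩ := A.exists_reflectionOf_eq hv
  rw [h]
  refine ⟨fun he => ?_, fun ⟨K, hK⟩ => A.conj_simple_eq_of_smul hK⟩
  -- The common reflection negates `w'.α j` and also shifts it by a multiple of `w.α i`.
  have h1 := A.σ_conj_simple w' j (A.σ w' (α j))
  rw [he, σ_conj_simple, σ_inv_σ, B_single, A.diag] at h1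
  refine ⟨A.B (α i) (A.σ w⁻¹ (A.σ w' (α j))), ?_⟩
  linear_combination (norm := module) (1 / 2 : ℝ) • h1

/-- The reflections of the Coxeter group of `M`. -/
def reflections (M : CoxeterMatrix I) : Set M.Group := {t | M.toCoxeterSystem.IsReflection t}

theorem card_fiber_reflectionOf [Finite A.W] {a b : ℕ}
    (h : ∀ i, a ≤ (A.posMultiples (α i)).ncard ∧ (A.posMultiples (α i)).ncard ≤ b) {t : A.W}
    (ht : t ∈ reflections A.coxeterMatrix) :
    a ≤ {v ∈ A.posRoots | A.reflectionOf v = t}.ncard ∧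
      {v ∈ A.posRoots | A.reflectionOf v = t}.ncard ≤ b := by
  -- Replacing `w` by `w s_i` does not change the reflection, so `w.α i` may be taken positive.
  obtain ⟨w, i, hw, rfl⟩ : ∃ w i, ¬ A.cs.IsRightDescent w i ∧
      t = w * A.cs.simple i * w⁻¹ := by
    obtain ⟨w, i, rfl⟩ := ht
    by_cases hw : A.cs.IsRightDescent w i
    · exact ⟨w * A.cs.simple i, i, A.cs.isRightDescent_iff_not_isRightDescent_mul.1 hw,
        by simp [mul_assoc]⟩
    · exact ⟨w, i, hw, rfl⟩
  have he : {v ∈ A.posRoots | A.reflectionOf v = w * A.cs.simple i * w⁻¹} =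
      A.posMultiples (A.σ w (α i)) := by
    ext v
    exact and_congr_right fun hv => A.reflectionOf_eq_iff hv.1 w i
  rw [he, A.ncard_posMultiples_σ (α_ne_zero i) (α_nonneg i) (A.σ_α_nonneg hw)]
  exact h i

theorem card_posRoots_bounds [Finite I] [Finite A.W] {a b : ℕ}
    (h : ∀ i, a ≤ (A.posMultiples (α i)).ncard ∧ (A.posMultiples (α i)).ncard ≤ b) :
    a * (reflections A.coxeterMatrix).ncard ≤ A.posRoots.ncard ∧
      A.posRoots.ncard ≤ b * (reflections A.coxeterMatrix).ncard := by
  classical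
  have hT : (reflections A.coxeterMatrix).Finite := Set.toFinite _
  have hP := A.finite_posRoots
  have hmaps : ∀ v ∈ hP.toFinset, A.reflectionOf v ∈ hT.toFinset := fun v hv => by
    rw [Set.Finite.mem_toFinset] at hv ⊢
    obtain ⟨w, i, -, h⟩ := A.exists_reflectionOf_eq hv.1
    exact ⟨w, i, h⟩
  have hfib : ∀ t, (hP.toFinset.filter fun v => A.reflectionOf v = t).card =
      {v ∈ A.posRoots | A.reflectionOf v = t}.ncard := fun t => by
    rw [← Set.ncard_coe_finset]
    congr 1
    ext v
    simp
  rw [Set.ncard_eq_toFinset_card _ hT, Set.ncard_eq_toFinset_card _ hP]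
  refine ⟨Finset.mul_card_image_le_card_of_maps_to hmaps a fun t ht => ?_,
    Finset.card_le_mul_card_image_of_maps_to hmaps b fun t ht => ?_⟩
  · rw [hfib]
    exact (A.card_fiber_reflectionOf h (hT.mem_toFinset.1 ht)).1
  · rw [hfib]
    exact (A.card_fiber_reflectionOf h (hT.mem_toFinset.1 ht)).2

end EGCM

theorem corollary3p11 {I : Type*} [Finite I] [Nonempty I] (A : EGCM I) (hW : Finite A.W) :
    A.posRoots.Finite ∧ A.std.posRoots.Finite ∧
    (∀ (C : A.onGraph.ConnectedComponent) (x : C.supp),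
      ((A.component C).posMultiples (Finsupp.single x 1)).Finite ∧
      ((A.component C).posMultiples (Finsupp.single x 1)).ncard = A.fComponent C) ∧
    ∃ f₁ f₂ : ℕ, IsLeast (Set.range A.fComponent) f₁ ∧ IsGreatest (Set.range A.fComponent) f₂ ∧
      f₁ * A.std.posRoots.ncard ≤ A.posRoots.ncard ∧
      A.posRoots.ncard ≤ f₂ * A.std.posRoots.ncard := by
  have hW' : Finite A.std.W := by
    rw [EGCM.W, A.std_coxeterMatrix]
    exact hW
  refine ⟨A.finite_posRoots, A.std.finite_posRoots, fun C x =>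
    ⟨EGCM.finite_posMultiples_component C x, ?_⟩, ?_⟩
  · rw [EGCM.ncard_posMultiples_component, EGCM.ncard_posMultiples_of_mem_supp]
  · have : Nonempty A.onGraph.ConnectedComponent :=
      ⟨A.onGraph.connectedComponentMk (Classical.arbitrary I)⟩
    have hfin : (Set.range A.fComponent).Finite := Set.finite_range _
    obtain ⟨f₁, h₁⟩ := hfin.exists_minimal (Set.range_nonempty _)
    obtain ⟨f₂, h₂⟩ := hfin.exists_maximal (Set.range_nonempty _)
    have h₁ : IsLeast (Set.range A.fComponent) f₁ := minimal_iff_isLeast.1 h₁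
    have h₂ : IsGreatest (Set.range A.fComponent) f₂ := maximal_iff_isGreatest.1 h₂
    -- All fibers are singletons in the standard representation.
    have hstd : A.std.posRoots.ncard = (EGCM.reflections A.coxeterMatrix).ncard := by
      have h := A.std.card_posRoots_bounds (a := 1) (b := 1) fun i => by
        rw [EGCM.ncard_posMultiples_of_symmetric A.std_symm]
        exact ⟨le_rfl, le_rfl⟩
      rw [A.std_coxeterMatrix, one_mul] at h
      exact le_antisymm h.2 h.1
    rw [hstd]
    refine ⟨f₁, f₂, h₁, h₂, A.card_posRoots_bounds fun i => ?_⟩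
    rw [EGCM.ncard_posMultiples_of_mem_supp (A.onGraph.connectedComponentMk i) ⟨i, rfl⟩]
    exact ⟨h₁.2 ⟨_, rfl⟩, h₂.2 ⟨_, rfl⟩⟩
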